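/- Let $K$ be an algebraically closed field (for instance $K=\mathbf C$), let $n\ge 0$, and let $B\subset GL_n(K)$ be the group of invertible upper triangular matrices. Write $[m]=\{1,\dots,m\}$, let $e_1,\dots,e_n$ be the standard basis of $K^n$, and for $C\subset[n]$ put $E_C=\mathrm{Span}\{e_j : j\in C\}$; in particular $K^m=E_{[m]}$. For a family $D$ of subsets of $[n]$ let $\mathrm{Gr}(D)=\prod_{C\in D}\mathrm{Gr}(|C|,K^n)$, with the diagonal action of $GL_n(K)$, and let $z_D=(E_C)_{C\in D}\in \mathrm{Gr}(D)$. Let $\mathbf i=(i_1,\dots,i_l)$, $1\le i_k\le n-1$, be a reduced word, that is, no shorter product of the simple transpositions $s_i=(i,i+1)$ equals the permutation $s_{i_1}\cdots s_{i_l}$ of $[n]$. Let $$D_{\mathbf i}=\{\,s_{i_1}\cdots s_{i_k}[i_k] : 1\le k\le l\,\},\qquad D_{\mathbf i}^+=\{[1],[2],\dots,[n]\}\cup D_{\mathbf i}.$$ Let $Z_{\mathbf i}=\overline{B\cdot z_{D_{\mathbf i}}}\subset \mathrm{Gr}(D_{\mathbf i})$ be the Bott–Samelson variety (Zariski closure),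 and let $$\mathcal I^B_{D_{\mathbf i}^+}=\{(V_C)\in \mathrm{Gr}(D_{\mathbf i}^+) : V_C\subset V_{C'}\text{ whenever } C\subset C',\ C,C'\in D_{\mathbf i}^+,\ \text{and } V_{[m]}=K^m \text{ for all } 1\le m\le n\}$$ be the flagged inclusion variety. Then $Z_{\mathbf i}\cong \mathcal I^B_{D_{\mathbf i}^+}$ as $B$-varieties (closed subvarieties with their reduced structure). More precisely, the projection $\mathrm{Gr}(D_{\mathbf i}^+)\to \mathrm{Gr}(D_{\mathbf i})$ that forgets the coordinates not in $D_{\mathbf i}$ restricts to a $B$-equivariant isomorphism of varieties $\mathcal I^B_{D_{\mathbf i}^+}\to Z_{\mathbf i}$, and inside $\mathrm{Gr}(D_{\mathbf i}^+)$ one has $\mathcal I^B_{D_{\mathbf i}^+}=\overline{B\cdot z_{D_{\mathbf i}^+}}$. -/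

import Mathlib

namespace BottSamelson

/-! ### Words, chamber families -/

section Combinatorics

variable {n : ℕ}

/-- The simple transposition `s_i = (i, i+1)`, `1 ≤ i ≤ n - 1`. The letter `i` is encoded by
`a = i - 1 : Fin (n - 1)`, and `{1, …, n}` by `Fin n`. -/
def simpleTransposition (a : Fin (n - 1)) : Equiv.Perm (Fin n) :=
  Equiv.swap ⟨a.1, by omega⟩ ⟨a.1 + 1, by omega⟩

/-- The product `s_{i_1} ⋯ s_{i_l}`. -/
def wordProd (i : List (Fin (n - 1))) : Equiv.Perm (Fin n) :=
  (i.map simpleTransposition).prod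

/-- A word is reduced if no shorter word has the same product. -/
def IsReducedWord (i : List (Fin (n - 1))) : Prop :=
  ∀ j : List (Fin (n - 1)), wordProd j = wordProd i → i.length ≤ j.length

/-- The initial interval `[m] = {1, …, m}` of `[n]`. -/
def initialInterval (n m : ℕ) : Finset (Fin n) :=
  Finset.univ.filter fun x => x.1 < m

/-- The reduced chamber family: the sets `s_{i_1} ⋯ s_{i_k} [i_k]`, for `1 ≤ k ≤ l`. -/
def chamberFamily (i : List (Fin (n - 1))) : Finset (Finset (Fin n)) :=
  Finset.univ.image fun k : Fin i.length =>
    (initialInterval n ((i.get k).1 + 1)).image (wordProd (i.take (k.1 + 1)))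

/-- The full chamber family: the reduced one together with `[1], [2], …, [n]`. -/
def fullChamberFamily (i : List (Fin (n - 1))) : Finset (Finset (Fin n)) :=
  (Finset.Icc 1 n).image (initialInterval n) ∪ chamberFamily i

theorem chamberFamily_subset (i : List (Fin (n - 1))) :
    chamberFamily i ⊆ fullChamberFamily i :=
  Finset.subset_union_right

end Combinatorics

/-! ### Products of Grassmannians -/

section Grassmannian

variable (K : Type*) [Field K] {n : ℕ}

/-- The Grassmannian `Gr(k, K^n)`. -/
def Gr (n k : ℕ) : Type _ :=
  {V : Submodule K (Fin n → K) // Module.finrank K V = k}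

/-- `Gr(D)`, the product over `C ∈ D` of the Grassmannians `Gr(|C|, K^n)`. -/
def GrProd (D : Finset (Finset (Fin n))) : Type _ :=
  ∀ C : {C // C ∈ D}, Gr K n C.1.card

/-- A frame for a point of `Gr(D)`: for each `C ∈ D`, an `n × |C|` matrix with linearly independent
columns. The product of Grassmannians is the quotient of the variety of frames by the group
`∏ GL(|C|)`. -/
def Frame (D : Finset (Finset (Fin n))) : Type _ :=
  {A : ∀ C : {C // C ∈ D}, Matrix (Fin n) (Fin C.1.card) K //
    ∀ C, LinearIndependent K (A C).col}

/-- The index set for the matrix entries of a frame. -/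
abbrev FrameIndex (D : Finset (Finset (Fin n))) : Type :=
  Σ C : {C // C ∈ D}, Fin n × Fin C.1.card

variable {K}

/-- The vector of all matrix entries of a frame. -/
def Frame.entries {D : Finset (Finset (Fin n))} (A : Frame K D) : FrameIndex D → K :=
  fun e => A.1 e.1 e.2.1 e.2.2

/-- The tuple of column spaces of a frame. -/
def Frame.toGrProd {D : Finset (Finset (Fin n))} (A : Frame K D) : GrProd K D := fun C =>
  ⟨Submodule.span K (Set.range (A.1 C).col), by
    rw [finrank_span_eq_card (A.2 C), Fintype.card_fin]⟩

variable (K)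

/-- The Zariski topology of the affine space `K^σ`, generated by the sets `{p ≠ 0}`. -/
@[reducible] def zariskiTopology (σ : Type*) : TopologicalSpace (σ → K) :=
  TopologicalSpace.generateFrom
    {U | ∃ p : MvPolynomial σ K, U = {x | MvPolynomial.eval x p ≠ 0}}

variable {K}

/-- The Zariski topology of `Gr(D)`: the quotient topology from the variety of frames, which is a
subspace of an affine space. -/
instance (D : Finset (Finset (Fin n))) : TopologicalSpace (GrProd K D) :=
  TopologicalSpace.coinduced Frame.toGrProd
    (TopologicalSpace.induced Frame.entries (zariskiTopology K (FrameIndex D)))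

/-- `f` is a regular function on the (locally closed) subset `S` of `Gr(D)`, with its reduced
structure: as a function of a frame for a point of `S`, it is locally a quotient of two polynomials
in the entries of the frame. Only the restriction of `f` to `S` matters. -/
def IsRegularOn {D : Finset (Finset (Fin n))} (S : Set (GrProd K D)) (f : GrProd K D → K) :
    Prop :=
  ∀ A : Frame K D, A.toGrProd ∈ S →
    ∃ p q : MvPolynomial (FrameIndex D) K, MvPolynomial.eval A.entries q ≠ 0 ∧
      ∀ A' : Frame K D, A'.toGrProd ∈ S → MvPolynomial.eval A'.entries q ≠ 0 →
        f A'.toGrProd = MvPolynomial.eval A'.entries p / MvPolynomial.eval A'.entries q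

/-- `φ` restricts to a morphism of varieties from `Y ⊆ Gr(D)` to `Y' ⊆ Gr(D')`: a continuous map
that pulls back regular functions on open subsets to regular functions. -/
def IsMorphismOn {D D' : Finset (Finset (Fin n))} (φ : GrProd K D → GrProd K D')
    (Y : Set (GrProd K D)) (Y' : Set (GrProd K D')) : Prop :=
  Set.MapsTo φ Y Y' ∧ ContinuousOn φ Y ∧
    ∀ U : Set (GrProd K D'), IsOpen U → ∀ f : GrProd K D' → K,
      IsRegularOn (Y' ∩ U) f → IsRegularOn (Y ∩ φ ⁻¹' U) (f ∘ φ)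

/-- `φ` restricts to an isomorphism of varieties from `Y` to `Y'`. -/
def IsIsomorphismOn {D D' : Finset (Finset (Fin n))} (φ : GrProd K D → GrProd K D')
    (Y : Set (GrProd K D)) (Y' : Set (GrProd K D')) : Prop :=
  IsMorphismOn φ Y Y' ∧ ∃ ψ : GrProd K D' → GrProd K D,
    IsMorphismOn ψ Y' Y ∧ Set.InvOn ψ φ Y Y'

/-- The projection `Gr(D') → Gr(D)` for `D ⊆ D'`, forgetting the other coordinates. -/
def GrProd.proj {D D' : Finset (Finset (Fin n))} (h : D ⊆ D') (x : GrProd K D') : GrProd K D :=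
  fun C => x ⟨C.1, h C.2⟩

/-! ### Group actions and the varieties -/

/-- The diagonal action of `GL(n)` on `Gr(D)`. -/
instance (D : Finset (Finset (Fin n))) :
    MulAction (Matrix.GeneralLinearGroup (Fin n) K) (GrProd K D) where
  smul g x := fun C => ⟨(x C).1.map (Matrix.mulVecLin g.1),
    (Submodule.equivMapOfInjective _ (Matrix.mulVec_injective_of_isUnit g.isUnit)
      (x C).1).finrank_eq.symm.trans (x C).2⟩
  one_smul x := by
    funext C
    apply Subtype.ext
    change (x C).1.map (Matrix.mulVecLin 1) = _
    rw [Matrix.mulVecLin_one, Submodule.map_id]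
  mul_smul g h x := by
    funext C
    apply Subtype.ext
    change (x C).1.map (Matrix.mulVecLin (g.1 * h.1)) =
      ((x C).1.map (Matrix.mulVecLin h.1)).map (Matrix.mulVecLin g.1)
    rw [Matrix.mulVecLin_mul, Submodule.map_comp]

variable (K)

/-- The Borel subgroup of upper triangular matrices in `GL(n)`. -/
def borel (n : ℕ) : Subgroup (Matrix.GeneralLinearGroup (Fin n) K) where
  carrier := {g | g.1.BlockTriangular id}
  one_mem' := Matrix.blockTriangular_one
  mul_mem' hg hh := Matrix.BlockTriangular.mul hg hh
  inv_mem' := by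
    intro g hg
    have := g.invertible
    have := Matrix.blockTriangular_inv_of_blockTriangular hg
    simpa using this

/-- The coordinate subspace `E_C`, spanned by the `e_j` with `j ∈ C`. -/
def coordinateSubspace (C : Finset (Fin n)) : Gr K n C.card :=
  ⟨Submodule.span K (Set.range fun j : C => (Pi.single j.1 1 : Fin n → K)), by
    rw [finrank_span_eq_card]
    · exact Fintype.card_coe C
    · exact (Pi.linearIndependent_single_one (Fin n) K).comp _ Subtype.val_injective⟩

/-- The point `z_D = (E_C)_{C ∈ D}` of `Gr(D)`. -/
def coordinatePoint (D : Finset (Finset (Fin n))) : GrProd K D :=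
  fun C => coordinateSubspace K C.1

/-- The flagged configuration variety of `D`: the Zariski closure of the orbit `B · z_D`. -/
def flaggedConfigurationVariety (D : Finset (Finset (Fin n))) : Set (GrProd K D) :=
  closure (MulAction.orbit (borel K n) (coordinatePoint K D))

/-- The Bott–Samelson variety of a word: the flagged configuration variety of its reduced chamber
family. -/
def bottSamelsonVariety (i : List (Fin (n - 1))) : Set (GrProd K (chamberFamily i)) :=
  flaggedConfigurationVariety K (chamberFamily i)

/-- The flagged inclusion variety of `D`: tuples `(V_C)` in `Gr(D)` with `V_C ⊆ V_{C'}` whenever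
`C ⊆ C'`, and with `V_{[m]} = K^m` (the span of `e_1, …, e_m`) whenever `[m] ∈ D`. -/
def flaggedInclusionVariety (D : Finset (Finset (Fin n))) : Set (GrProd K D) :=
  {x | (∀ C C' : {C // C ∈ D}, C.1 ⊆ C'.1 → (x C).1 ≤ (x C').1) ∧
    ∀ m : ℕ, ∀ h : initialInterval n m ∈ D,
      x ⟨initialInterval n m, h⟩ = coordinateSubspace K (initialInterval n m)}

end Grassmannian

end BottSamelson

open BottSamelson

/-! A point of the inclusion variety is a gallery of flags. With w_k = s_{i_1} ⋯ s_{i_k}, the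
subspaces V_{w_k[j]} form the k-th flag; flag 0 is standard, and passing from one flag to the next
changes a single member, which moves in a pencil.

The orbit lies in the inclusion variety because incidence and V_{[m]} = K^m are closed, B-stable
conditions. Conversely, `exists_polynomial_gallery` deforms a gallery polynomially in t so that for
t ≠ 0 no two consecutive flags coincide. Since the word is reduced, such a gallery is a B-translate
of the coordinate gallery: each step is corrected by one upper transvection, which by
`IsReducedWord.lt` fixes all earlier coordinate flags. As K is infinite, the value at t = 0 lies in
the closure of the orbit (`mem_closure_of_polynomial_family`).

For the isomorphism, the forgotten coordinates are the constants K^m, so refilling them inverts the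
projection. Both maps are polynomial on frames, hence morphisms, and both match the two B-orbits,
hence their closures. -/

namespace BottSamelson

/-! ### Reduced words and the sets w_k[j]. -/

section Words

variable {n : ℕ}

/-- The position `a` of the letter `a`, as an element of `Fin n`. -/
def letterFst (a : Fin (n - 1)) : Fin n := ⟨a.1, by omega⟩

/-- The position `a + 1` following the letter `a`, as an element of `Fin n`. -/
def letterSnd (a : Fin (n - 1)) : Fin n := ⟨a.1 + 1, by omega⟩

theorem letterFst_lt_letterSnd (a : Fin (n - 1)) : letterFst a < letterSnd a :=
  Nat.lt_succ_self a.1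

theorem simpleTransposition_eq (a : Fin (n - 1)) :
    simpleTransposition a = Equiv.swap (letterFst a) (letterSnd a) := rfl

theorem wordProd_append (i j : List (Fin (n - 1))) :
    wordProd (i ++ j) = wordProd i * wordProd j := by
  simp [wordProd]

theorem wordProd_cons (a : Fin (n - 1)) (j : List (Fin (n - 1))) :
    wordProd (a :: j) = simpleTransposition a * wordProd j := by
  simp [wordProd]

/-- A simple transposition reverses the order of two positions only if it exchanges them. -/
theorem eq_letters_of_simpleTransposition_lt (b : Fin (n - 1)) {x y : Fin n} (hxy : x < y)
    (h : simpleTransposition b y < simpleTransposition b x) :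
    x = letterFst b ∧ y = letterSnd b := by
  rw [simpleTransposition_eq, Equiv.swap_apply_def, Equiv.swap_apply_def] at h
  simp only [letterFst, letterSnd, Fin.ext_iff, Fin.lt_def] at *
  split_ifs at h <;> simp_all <;> omega

/-- The exchange condition. -/
theorem exists_shorter_word (a : Fin (n - 1)) (j : List (Fin (n - 1)))
    (h : wordProd j (letterSnd a) < wordProd j (letterFst a)) :
    ∃ j' : List (Fin (n - 1)), j'.length < j.length ∧
      wordProd j' = wordProd j * simpleTransposition a := by
  induction j with
  | nil => exact absurd h (by simpa [wordProd] using (letterFst_lt_letterSnd a).le)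
  | cons b t ih =>
    rw [wordProd_cons] at h
    rcases lt_trichotomy (wordProd t (letterFst a)) (wordProd t (letterSnd a)) with hlt | heq | hgt
    -- Here the inversion is created by b itself, so s_b t s_a = t and the letter b can be deleted.
    · obtain ⟨h1, h2⟩ := eq_letters_of_simpleTransposition_lt b hlt h
      refine ⟨t, by simp, ?_⟩
      rw [wordProd_cons, mul_assoc, simpleTransposition_eq a, Equiv.mul_swap_eq_swap_mul, h1, h2,
        ← simpleTransposition_eq, ← mul_assoc, simpleTransposition_eq, Equiv.swap_mul_self, one_mul]
    · exact absurd ((wordProd t).injective heq) (letterFst_lt_letterSnd a).ne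
    · obtain ⟨j', hj, hp⟩ := ih hgt
      exact ⟨b :: j', by simpa using hj, by rw [wordProd_cons, wordProd_cons, hp, mul_assoc]⟩

/-- An inversion here would, by exchange, shorten the subword from m through the letter at k, and
with it the whole word. Consequently the transvection attached to step k is upper triangular (m = 0)
and fixes every coordinate subspace of flag m. -/
theorem IsReducedWord.lt {i : List (Fin (n - 1))} (hi : IsReducedWord i) {m k : ℕ} (hmk : m ≤ k)
    (hk : k < i.length) :
    (wordProd (i.take m))⁻¹ (wordProd (i.take k) (letterFst i[k])) <
      (wordProd (i.take m))⁻¹ (wordProd (i.take k) (letterSnd i[k])) := by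
  have e : i.take k = i.take m ++ (i.take k).drop m := by
    conv_lhs => rw [← List.take_append_drop m (i.take k), List.take_take, min_eq_left hmk]
  have e2 : wordProd (i.take k) = wordProd (i.take m) * wordProd ((i.take k).drop m) := by
    rw [← wordProd_append, ← e]
  have e3 : ∀ y, (wordProd (i.take m))⁻¹ (wordProd (i.take k) y) =
      wordProd ((i.take k).drop m) y := fun y => by simp [e2]
  rw [e3, e3]
  refine lt_of_le_of_ne (not_lt.1 fun hlt => ?_) fun heq =>
    (letterFst_lt_letterSnd i[k]).ne (Equiv.injective _ heq)
  obtain ⟨j', hj, hp⟩ := exists_shorter_word _ _ hlt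
  have hl := hi (i.take m ++ (j' ++ i.drop (k + 1))) (by
    conv_rhs => rw [← List.take_append_drop k i, List.drop_eq_getElem_cons hk]
    rw [wordProd_append, wordProd_append, hp, wordProd_append, wordProd_cons, e2]
    simp only [mul_assoc])
  simp only [List.length_append, List.length_take, List.length_drop] at hl hj
  omega

theorem mem_initialInterval {m : ℕ} {x : Fin n} : x ∈ initialInterval n m ↔ x.1 < m := by
  simp [initialInterval]

theorem mem_image_initialInterval {w : Equiv.Perm (Fin n)} {m : ℕ} {x : Fin n} :
    x ∈ (initialInterval n m).image w ↔ (w⁻¹ x).1 < m := by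
  rw [Finset.mem_image]
  constructor
  · rintro ⟨y, hy, rfl⟩
    simpa using mem_initialInterval.1 hy
  · exact fun h => ⟨w⁻¹ x, mem_initialInterval.2 h, by simp⟩

theorem image_one_initialInterval (m : ℕ) :
    (initialInterval n m).image (1 : Equiv.Perm (Fin n)) = initialInterval n m := by
  ext x; simp [mem_initialInterval]

theorem card_initialInterval {m : ℕ} (hm : m ≤ n) : (initialInterval n m).card = m := by
  rw [initialInterval, Fin.card_filter_val_lt, min_eq_right hm]

theorem card_image_initialInterval (w : Equiv.Perm (Fin n)) {m : ℕ} (hm : m ≤ n) :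
    ((initialInterval n m).image w).card = m := by
  rw [Finset.card_image_of_injective _ w.injective, card_initialInterval hm]

/-- Both exchanged positions lie in [j] or neither does; hence consecutive flags differ in one
member only. -/
theorem image_mul_simpleTransposition (w : Equiv.Perm (Fin n)) (a : Fin (n - 1)) {j : ℕ}
    (hj : j ≠ a.1 + 1) :
    (initialInterval n j).image (w * simpleTransposition a) = (initialInterval n j).image w := by
  ext x
  rw [mem_image_initialInterval, mem_image_initialInterval, mul_inv_rev, Equiv.Perm.mul_apply,
    simpleTransposition_eq, Equiv.swap_inv, Equiv.swap_apply_def]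
  simp only [letterFst, letterSnd, Fin.ext_iff]
  split_ifs <;> simp_all <;> omega

theorem image_initialInterval_letter (w : Equiv.Perm (Fin n)) (a : Fin (n - 1)) :
    (initialInterval n (a.1 + 1)).image w =
      insert (w (letterFst a)) ((initialInterval n a.1).image w) := by
  rw [← Finset.image_insert]
  congr 1
  ext x
  simp only [letterFst, mem_initialInterval, Finset.mem_insert, Fin.ext_iff]
  omega

theorem image_initialInterval_letter_add_two (w : Equiv.Perm (Fin n)) (a : Fin (n - 1)) :
    (initialInterval n (a.1 + 2)).image w =
      insert (w (letterFst a)) (insert (w (letterSnd a)) ((initialInterval n a.1).image w)) := by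
  rw [← Finset.image_insert, ← Finset.image_insert]
  congr 1
  ext x
  simp only [letterFst, letterSnd, mem_initialInterval, Finset.mem_insert, Fin.ext_iff]
  omega

theorem image_mul_initialInterval_letter (w : Equiv.Perm (Fin n)) (a : Fin (n - 1)) :
    (initialInterval n (a.1 + 1)).image (w * simpleTransposition a) =
      insert (w (letterSnd a)) ((initialInterval n a.1).image w) := by
  rw [image_initialInterval_letter, image_mul_simpleTransposition _ _ (by omega),
    Equiv.Perm.mul_apply, simpleTransposition_eq, Equiv.swap_apply_left]

theorem wordProd_take_succ (i : List (Fin (n - 1))) {k : ℕ} (hk : k < i.length) :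
    wordProd (i.take (k + 1)) = wordProd (i.take k) * simpleTransposition i[k] := by
  rw [List.take_add_one, List.getElem?_eq_getElem hk, wordProd_append]
  simp [wordProd]

theorem exists_eq_image_of_mem_fullChamberFamily {i : List (Fin (n - 1))} {C : Finset (Fin n)}
    (hC : C ∈ fullChamberFamily i) :
    ∃ k ≤ i.length, C = (initialInterval n C.card).image (wordProd (i.take k)) := by
  rw [fullChamberFamily, Finset.mem_union] at hC
  rcases hC with hC | hC
  · obtain ⟨m, hm, rfl⟩ := Finset.mem_image.1 hC
    refine ⟨0, Nat.zero_le _, ?_⟩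
    rw [card_initialInterval (Finset.mem_Icc.1 hm).2]
    exact (image_one_initialInterval m).symm
  · obtain ⟨k, -, rfl⟩ := Finset.mem_image.1 hC
    refine ⟨k.1 + 1, k.2, ?_⟩
    rw [card_image_initialInterval _ (by omega)]

/-- Each step introduces one new set, a chamber set by definition; the others are inherited from the
previous flag. Thus every w_k[j] with 1 ≤ j ≤ n carries a coordinate. -/
theorem image_mem_fullChamberFamily (i : List (Fin (n - 1))) {k j : ℕ} (hk : k ≤ i.length)
    (hj0 : 1 ≤ j) (hj : j ≤ n) :
    (initialInterval n j).image (wordProd (i.take k)) ∈ fullChamberFamily i := by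
  induction k with
  | zero =>
    refine Finset.mem_union_left _ (Finset.mem_image.2 ⟨j, Finset.mem_Icc.2 ⟨hj0, hj⟩, ?_⟩)
    exact (image_one_initialInterval j).symm
  | succ k ih =>
    by_cases h : j = (i[k]).1 + 1
    · refine Finset.mem_union_right _ (Finset.mem_image.2 ⟨⟨k, hk⟩, Finset.mem_univ _, ?_⟩)
      rw [h]; rfl
    · rw [wordProd_take_succ i hk, image_mul_simpleTransposition _ _ h]
      exact ih (by omega)

end Words


/-! ### Coordinate subspaces, transvections and pencils. -/

section CoordinateSubspaces

open Matrix

variable (K : Type*) [Field K] {n : ℕ}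

/-- The coordinate subspace `E_C` as a submodule. -/
def coordSpan (C : Finset (Fin n)) : Submodule K (Fin n → K) :=
  (coordinateSubspace K C).1

theorem finrank_coordSpan (C : Finset (Fin n)) : Module.finrank K (coordSpan K C) = C.card :=
  (coordinateSubspace K C).2

variable {K}

theorem mem_coordSpan {C : Finset (Fin n)} {v : Fin n → K} :
    v ∈ coordSpan K C ↔ ∀ r, r ∉ C → v r = 0 := by
  constructor
  · intro hv r hr
    have : coordSpan K C ≤ LinearMap.ker (LinearMap.proj (R := K) (φ := fun _ => K) r) := by
      refine Submodule.span_le.2 ?_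
      rintro _ ⟨j, rfl⟩
      have : r ≠ j.1 := fun h => hr (h ▸ j.2)
      simp [this]
    exact this hv
  · intro h
    have : v = ∑ r ∈ C, v r • (Pi.single r 1 : Fin n → K) := by
      ext s
      rw [Finset.sum_apply]
      simp only [Pi.smul_apply, Pi.single_apply, smul_eq_mul, mul_ite, mul_one, mul_zero]
      rw [Finset.sum_ite_eq]
      split_ifs with hs
      · rfl
      · exact h s hs
    rw [this]
    exact Submodule.sum_mem _ fun r hr => Submodule.smul_mem _ _
      (Submodule.subset_span ⟨⟨r, hr⟩, rfl⟩)

theorem coordSpan_mono {C C' : Finset (Fin n)} (h : C ⊆ C') : coordSpan K C ≤ coordSpan K C' :=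
  fun _ hv => mem_coordSpan.2 fun r hr => mem_coordSpan.1 hv r fun hrC => hr (h hrC)

theorem finrank_map_mulVecLin {g : Matrix (Fin n) (Fin n) K} (hg : IsUnit g)
    (W : Submodule K (Fin n → K)) :
    Module.finrank K (W.map g.mulVecLin) = Module.finrank K W :=
  (Submodule.equivMapOfInjective _ (mulVec_injective_of_isUnit hg) W).finrank_eq.symm

theorem map_mulVecLin_eq_self {g : Matrix (Fin n) (Fin n) K} (hg : IsUnit g)
    {W : Submodule K (Fin n → K)} (h : W.map g.mulVecLin ≤ W) : W.map g.mulVecLin = W :=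
  Submodule.eq_of_le_of_finrank_eq h (finrank_map_mulVecLin hg W)

theorem map_mulVecLin_map (g h : Matrix (Fin n) (Fin n) K) (W : Submodule K (Fin n → K)) :
    (W.map h.mulVecLin).map g.mulVecLin = W.map (g * h).mulVecLin := by
  rw [mulVecLin_mul, Submodule.map_comp]

theorem transvection_mulVec (p q : Fin n) (c : K) (v : Fin n → K) (r : Fin n) :
    (transvection p q c *ᵥ v) r = v r + if r = p then c * v q else 0 := by
  rw [transvection, add_mulVec, one_mulVec, Pi.add_apply, single_mulVec]
  simp [Function.update_apply]

theorem isUnit_transvection {p q : Fin n} (h : p ≠ q) (c : K) : IsUnit (transvection p q c) := by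
  rw [isUnit_iff_isUnit_det, det_transvection_of_ne _ _ h]
  exact isUnit_one

/-- Only the p-coordinate changes, by c times the q-coordinate. The order relations of a reduced
word supply the hypothesis on C. -/
theorem map_transvection_coordSpan {p q : Fin n} (h : p ≠ q) (c : K) {C : Finset (Fin n)}
    (hC : q ∈ C → p ∈ C) :
    (coordSpan K C).map (transvection p q c).mulVecLin = coordSpan K C := by
  refine map_mulVecLin_eq_self (isUnit_transvection h c) ?_
  rintro _ ⟨v, hv, rfl⟩
  refine mem_coordSpan.2 fun r hr => ?_
  have hv' := mem_coordSpan.1 hv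
  rw [mulVecLin_apply, transvection_mulVec, hv' r hr]
  split_ifs with hrp
  · rw [hv' q fun hq => hr (hrp ▸ hC hq)]; simp
  · simp

/-- A subspace in the pencil between `E_S` and `E_{S ∪ {p, q}}`, other than `E_{S ∪ {p}}`, is the
image of `E_{S ∪ {q}}` under a transvection. -/
theorem exists_eq_map_transvection {S : Finset (Fin n)} {p q : Fin n} (hp : p ∉ S) (hq : q ∉ S)
    (hpq : p ≠ q) {V : Submodule K (Fin n → K)} (h1 : coordSpan K S ≤ V)
    (h2 : V ≤ coordSpan K (insert p (insert q S))) (h3 : Module.finrank K V = S.card + 1)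
    (h4 : V ≠ coordSpan K (insert p S)) :
    ∃ c, V = (coordSpan K (insert q S)).map (transvection p q c).mulVecLin := by
  have hle : ¬ V ≤ coordSpan K (insert p S) := fun hle => h4 <|
    Submodule.eq_of_le_of_finrank_eq hle <| by
      rw [h3, finrank_coordSpan, Finset.card_insert_of_notMem hp]
  obtain ⟨v, hv, hvp⟩ := SetLike.not_le_iff_exists.1 hle
  have hv2 := mem_coordSpan.1 (h2 hv)
  have hvq : v q ≠ 0 := fun h0 => hvp <| mem_coordSpan.2 fun r hr => by
    by_cases hrq : r = q
    · rw [hrq, h0]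
    · exact hv2 r (by simp only [Finset.mem_insert, not_or] at hr ⊢; exact ⟨hr.1, hrq, hr.2⟩)
  -- Modulo E_S, the vector v / v_q is e_q + c e_p with this c, and it spans V together with E_S.
  refine ⟨v p / v q, (Submodule.eq_of_le_of_finrank_eq ?_ ?_).symm⟩
  · rintro _ ⟨u, hu, rfl⟩
    have hu' := mem_coordSpan.1 hu
    have key : transvection p q (v p / v q) *ᵥ u - (u q / v q) • v ∈ V := by
      refine h1 (mem_coordSpan.2 fun r hr => ?_)
      rw [Pi.sub_apply, transvection_mulVec, Pi.smul_apply, smul_eq_mul]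
      by_cases hrp : r = p
      · subst hrp
        rw [hu' r (by simp [hr, hpq]), if_pos rfl]
        ring
      · rw [if_neg hrp]
        by_cases hrq : r = q
        · subst hrq
          field_simp
          ring
        · rw [hu' r (by simp [hr, hrq]), hv2 r (by simp [hr, hrq, hrp])]
          ring
    have := V.add_mem key (V.smul_mem (u q / v q) hv)
    rwa [sub_add_cancel] at this
  · rw [finrank_map_mulVecLin (isUnit_transvection hpq _), finrank_coordSpan, h3,
      Finset.card_insert_of_notMem hq]

theorem transvection_mem_borel {p q : Fin n} (h : p < q) (c : K) :
    (isUnit_transvection h.ne c).unit ∈ borel K n := by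
  intro r s hsr
  change transvection p q c r s = 0
  simp only [id] at hsr
  rw [transvection, Matrix.add_apply, one_apply_ne hsr.ne', single_apply, zero_add, if_neg]
  rintro ⟨rfl, rfl⟩
  exact absurd h hsr.not_gt

theorem map_borel_coordSpan {b : GeneralLinearGroup (Fin n) K} (hb : b ∈ borel K n) (m : ℕ) :
    (coordSpan K (initialInterval n m)).map (mulVecLin b.1) =
      coordSpan K (initialInterval n m) := by
  refine map_mulVecLin_eq_self b.isUnit ?_
  rintro _ ⟨v, hv, rfl⟩
  refine mem_coordSpan.2 fun r hr => ?_
  rw [mulVecLin_apply, mulVec, dotProduct]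
  refine Finset.sum_eq_zero fun s _ => ?_
  rw [mem_initialInterval] at hr
  by_cases hs : s.1 < m
  · have : b.1 r s = 0 := hb (show s < r from Fin.lt_def.2 (by omega))
    rw [this, zero_mul]
  · rw [mem_coordSpan.1 hv s (by rwa [mem_initialInterval]), mul_zero]

end CoordinateSubspaces


/-! ### Polynomial deformation of galleries. -/

section Deformation

open Matrix Polynomial

variable {K : Type*} [Field K] {n : ℕ}

/-- The value at `t` of a matrix of polynomials. -/
noncomputable def evalMat (t : K) : Matrix (Fin n) (Fin n) K[X] →+* Matrix (Fin n) (Fin n) K :=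
  (evalRingHom t).mapMatrix

theorem evalMat_apply (t : K) (P : Matrix (Fin n) (Fin n) K[X]) (r s : Fin n) :
    evalMat t P r s = (P r s).eval t := rfl

theorem evalMat_map_C (t : K) (M : Matrix (Fin n) (Fin n) K) : evalMat t (M.map C) = M := by
  ext r s
  rw [evalMat_apply, map_apply, eval_C]

theorem evalMat_transvection_X (t : K) (p q : Fin n) :
    evalMat t (transvection p q (X : K[X])) = transvection p q t := by
  ext r s
  rw [evalMat_apply, transvection, transvection, Matrix.add_apply, Matrix.add_apply, eval_add,
    single_apply, single_apply, one_apply, one_apply]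
  congr 1 <;> split_ifs <;> simp

theorem isUnit_permMatrix (σ : Equiv.Perm (Fin n)) : IsUnit (σ.permMatrix K) := by
  rw [← mulVec_injective_iff_isUnit]
  intro u v h
  rw [permMatrix_mulVec, permMatrix_mulVec] at h
  exact σ.surjective.injective_comp_right h

/-- The permutation matrix acts by v ↦ v ∘ σ, so it moves supports by σ⁻¹. -/
theorem map_permMatrix_coordSpan (σ : Equiv.Perm (Fin n)) (C : Finset (Fin n)) :
    (coordSpan K (C.image σ)).map (σ.permMatrix K).mulVecLin = coordSpan K C := by
  refine Submodule.eq_of_le_of_finrank_eq ?_ ?_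
  · rintro _ ⟨v, hv, rfl⟩
    refine mem_coordSpan.2 fun r hr => ?_
    rw [mulVecLin_apply, permMatrix_mulVec]
    refine mem_coordSpan.1 hv _ fun h => hr ?_
    obtain ⟨s, hs, hsr⟩ := Finset.mem_image.1 h
    rwa [← σ.injective hsr]
  · rw [finrank_map_mulVecLin (isUnit_permMatrix σ), finrank_coordSpan, finrank_coordSpan,
      Finset.card_image_of_injective _ σ.injective]

theorem initialInterval_letter_eq_insert (a : Fin (n - 1)) :
    initialInterval n (a.1 + 1) = insert (letterFst a) (initialInterval n a.1) := by
  simpa [image_one_initialInterval] using image_initialInterval_letter 1 a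

theorem initialInterval_letter_add_two_eq_insert (a : Fin (n - 1)) :
    initialInterval n (a.1 + 2) =
      insert (letterFst a) (insert (letterSnd a) (initialInterval n a.1)) := by
  simpa [image_one_initialInterval] using image_initialInterval_letter_add_two 1 a

theorem letterFst_mem_initialInterval {a : Fin (n - 1)} {j : ℕ} :
    letterFst a ∈ initialInterval n j ↔ a.1 < j := mem_initialInterval

theorem letterSnd_mem_initialInterval {a : Fin (n - 1)} {j : ℕ} :
    letterSnd a ∈ initialInterval n j ↔ a.1 + 1 < j := mem_initialInterval

/-- Any member `V` of the pencil between `K^a` and `K^(a+2)` is the value at `0` of a polynomial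
family of members, those at `t ≠ 0` being different from `K^(a+1)`. -/
theorem exists_polynomial_pencil (a : Fin (n - 1)) {V : Submodule K (Fin n → K)}
    (h1 : coordSpan K (initialInterval n a.1) ≤ V)
    (h2 : V ≤ coordSpan K (initialInterval n (a.1 + 2))) (h3 : Module.finrank K V = a.1 + 1) :
    ∃ P : Matrix (Fin n) (Fin n) K[X], (∀ t, IsUnit (evalMat t P)) ∧
      (∀ t j, j ≠ a.1 + 1 → (coordSpan K (initialInterval n j)).map (evalMat t P).mulVecLin =
        coordSpan K (initialInterval n j)) ∧
      (coordSpan K (initialInterval n (a.1 + 1))).map (evalMat 0 P).mulVecLin = V ∧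
      ∀ t ≠ 0, (coordSpan K (initialInterval n (a.1 + 1))).map (evalMat t P).mulVecLin ≠
        coordSpan K (initialInterval n (a.1 + 1)) := by
  have hne := (letterFst_lt_letterSnd a).ne
  by_cases hV : V = coordSpan K (initialInterval n (a.1 + 1))
  -- The degenerate member is moved away by a lower transvection with parameter t, which is the
  -- identity at t = 0.
  · refine ⟨transvection (letterSnd a) (letterFst a) X, fun t => ?_, fun t j hj => ?_, ?_,
      fun t ht h => ?_⟩
    · rw [evalMat_transvection_X]
      exact isUnit_transvection hne.symm t
    · rw [evalMat_transvection_X, map_transvection_coordSpan hne.symm]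
      rw [letterFst_mem_initialInterval, letterSnd_mem_initialInterval]
      omega
    · rw [evalMat_transvection_X, transvection_zero, mulVecLin_one, Submodule.map_id, hV]
    · have hmem : (Pi.single (letterFst a) 1 : Fin n → K) ∈
          coordSpan K (initialInterval n (a.1 + 1)) := by
        refine mem_coordSpan.2 fun r hr => Pi.single_eq_of_ne ?_ _
        rintro rfl
        exact hr (letterFst_mem_initialInterval.2 (by omega))
      have h' := mem_coordSpan.1 (h.le (Submodule.mem_map_of_mem hmem)) (letterSnd a)
        (by rw [letterSnd_mem_initialInterval]; omega)
      rw [evalMat_transvection_X, mulVecLin_apply, transvection_mulVec, if_pos rfl,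
        Pi.single_eq_same, Pi.single_eq_of_ne hne.symm, zero_add, mul_one] at h'
      exact ht h'
  · have hf : letterFst a ∉ initialInterval n a.1 := by rw [letterFst_mem_initialInterval]; omega
    have hs : letterSnd a ∉ initialInterval n a.1 := by rw [letterSnd_mem_initialInterval]; omega
    rw [initialInterval_letter_add_two_eq_insert] at h2
    have hV' := hV
    rw [initialInterval_letter_eq_insert] at hV'
    obtain ⟨c, hc⟩ := exists_eq_map_transvection hf hs hne h1 h2
      (by rw [h3, card_initialInterval (by omega)]) hV'
    have himg : insert (letterSnd a) (initialInterval n a.1) =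
        (initialInterval n (a.1 + 1)).image (simpleTransposition a) := by
      have := image_mul_initialInterval_letter 1 a
      rw [one_mul, image_one_initialInterval] at this
      exact this.symm
    have hperm : (coordSpan K (initialInterval n (a.1 + 1))).map
        ((simpleTransposition a).permMatrix K).mulVecLin =
          coordSpan K (insert (letterSnd a) (initialInterval n a.1)) := by
      rw [← map_permMatrix_coordSpan (simpleTransposition a) (insert _ _), himg,
        Finset.image_image]
      have : simpleTransposition a ∘ simpleTransposition a = id := by
        funext x
        simp [simpleTransposition_eq]
      rw [this, Finset.image_id]
    have hstep : (coordSpan K (initialInterval n (a.1 + 1))).map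
        (transvection (letterFst a) (letterSnd a) c *
          (simpleTransposition a).permMatrix K).mulVecLin = V := by
      rw [← map_mulVecLin_map, hperm, ← hc]
    -- Here V already differs from K^(a+1), so a constant family suffices.
    refine ⟨(transvection (letterFst a) (letterSnd a) c *
      (simpleTransposition a).permMatrix K).map C, fun t => ?_, fun t j hj => ?_, ?_,
        fun t _ => ?_⟩
    · rw [evalMat_map_C]
      exact (isUnit_transvection hne c).mul (isUnit_permMatrix _)
    · rw [evalMat_map_C, ← map_mulVecLin_map]
      have : (initialInterval n j).image (simpleTransposition a) = initialInterval n j := by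
        have := image_mul_simpleTransposition 1 a hj
        rwa [one_mul, image_one_initialInterval] at this
      conv_lhs => rw [← this]
      rw [map_permMatrix_coordSpan, map_transvection_coordSpan hne]
      rw [letterFst_mem_initialInterval, letterSnd_mem_initialInterval]
      omega
    · rw [evalMat_map_C, hstep]
    · rw [evalMat_map_C, hstep]
      exact hV

/-- A gallery `F` of flags, starting at the standard flag and following the permutations `w`, is
the value at `0` of a polynomial family of galleries, those at `t ≠ 0` being translates by the
Borel subgroup of the gallery of coordinate flags. -/
theorem exists_polynomial_gallery {w : ℕ → Equiv.Perm (Fin n)} {l : ℕ} (hw0 : w 0 = 1)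
    (hw : ∀ k < l, ∃ a, w (k + 1) = w k * simpleTransposition a ∧
      ∀ m ≤ k, (w m)⁻¹ (w k (letterFst a)) < (w m)⁻¹ (w k (letterSnd a)))
    {F : Finset (Fin n) → Submodule K (Fin n → K)}
    (hF0 : ∀ j, F (initialInterval n j) = coordSpan K (initialInterval n j))
    (hFr : ∀ C, Module.finrank K (F C) = C.card)
    (hFm : ∀ k ≤ l, ∀ j, j + 1 ≤ n →
      F ((initialInterval n j).image (w k)) ≤ F ((initialInterval n (j + 1)).image (w k))) :
    ∃ G : ℕ → Matrix (Fin n) (Fin n) K[X], (∀ k ≤ l, ∀ t, IsUnit (evalMat t (G k))) ∧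
      (∀ k ≤ l, ∀ j, (coordSpan K (initialInterval n j)).map (evalMat 0 (G k)).mulVecLin =
        F ((initialInterval n j).image (w k))) ∧
      ∀ t ≠ 0, ∃ b ∈ borel K n, ∀ k ≤ l, ∀ j,
        (coordSpan K (initialInterval n j)).map (evalMat t (G k)).mulVecLin =
          (coordSpan K ((initialInterval n j).image (w k))).map (mulVecLin b.1) := by
  induction l with
  | zero =>
    refine ⟨fun _ => 1, fun k _ t => ?_, fun k hk j => ?_, fun t _ => ⟨1, one_mem _, ?_⟩⟩
    · rw [map_one]
      exact isUnit_one
    · rw [map_one, mulVecLin_one, Submodule.map_id, Nat.le_zero.1 hk, hw0,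
        image_one_initialInterval, hF0]
    · intro k hk j
      rw [map_one, Nat.le_zero.1 hk, hw0, image_one_initialInterval]
      rfl
  | succ l ih =>
    obtain ⟨G, hGu, hG0, hGt⟩ := ih (fun k hk => hw k (by omega)) fun k hk => hFm k (by omega)
    obtain ⟨a, hwa, hasc⟩ := hw l (by omega)
    have hgu := hGu l le_rfl 0
    -- The matrix g = G_l(0) carries the standard flag to the l-th flag, so g⁻¹ brings the new
    -- member into the standard pencil.
    obtain ⟨g, hg⟩ := hgu
    have hginv : ∀ W : Submodule K (Fin n → K),
        (W.map g⁻¹.1.mulVecLin).map g.1.mulVecLin = W := fun W => by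
      rw [map_mulVecLin_map, Units.mul_inv, mulVecLin_one, Submodule.map_id]
    have hginv' : ∀ W : Submodule K (Fin n → K),
        (W.map g.1.mulVecLin).map g⁻¹.1.mulVecLin = W := fun W => by
      rw [map_mulVecLin_map, Units.inv_mul, mulVecLin_one, Submodule.map_id]
    have himg : ∀ j, j ≠ a.1 + 1 →
        (initialInterval n j).image (w (l + 1)) = (initialInterval n j).image (w l) :=
      fun j hj => by rw [hwa, image_mul_simpleTransposition _ _ hj]
    have hold : ∀ j, (F ((initialInterval n j).image (w l))).map g⁻¹.1.mulVecLin =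
        coordSpan K (initialInterval n j) := fun j => by
      rw [← hG0 l le_rfl j, ← hg, hginv']
    have ha := a.2
    obtain ⟨P, hPu, hPj, hP0, hPt⟩ := exists_polynomial_pencil (K := K) a
      (V := (F ((initialInterval n (a.1 + 1)).image (w (l + 1)))).map g⁻¹.1.mulVecLin)
      (by
        rw [← hold, ← himg a.1 (by omega)]
        exact Submodule.map_mono (hFm (l + 1) le_rfl a.1 (by omega)))
      (by
        rw [← hold (a.1 + 2), ← himg (a.1 + 2) (by omega)]
        exact Submodule.map_mono (hFm (l + 1) le_rfl (a.1 + 1) (by omega)))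
      (by
        rw [finrank_map_mulVecLin g⁻¹.isUnit, hFr, card_image_initialInterval _ (by omega)])
    -- Multiplying by P on the right preserves all members of the last flag except the one in
    -- position a + 1.
    refine ⟨fun k => if k ≤ l then G k else G l * P, fun k hk t => ?_, fun k hk j => ?_,
      fun t ht => ?_⟩
    · dsimp only
      split_ifs with hkl
      · exact hGu k hkl t
      · rw [map_mul]
        exact (hGu l le_rfl t).mul (hPu t)
    · dsimp only
      split_ifs with hkl
      · exact hG0 k hkl j
      · obtain rfl : k = l + 1 := by omega
        rw [map_mul, ← map_mulVecLin_map]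
        by_cases hj : j = a.1 + 1
        · rw [hj, hP0, ← hg, hginv]
        · rw [hPj 0 j hj, himg j hj, hG0 l le_rfl]
    · obtain ⟨b, hb, hbk⟩ := hGt t ht
      have hlt : w l (letterFst a) < w l (letterSnd a) := by
        simpa [hw0] using hasc 0 (Nat.zero_le _)
      -- the new subspace, transported back by `b`
      set V := ((coordSpan K (initialInterval n (a.1 + 1))).map
        (evalMat t (G l * P)).mulVecLin).map (b⁻¹).1.mulVecLin with hVdef
      have hbinv : ∀ W : Submodule K (Fin n → K),
          (W.map b.1.mulVecLin).map b⁻¹.1.mulVecLin = W := fun W => by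
        rw [map_mulVecLin_map, Units.inv_mul, mulVecLin_one, Submodule.map_id]
      have hbinv' : ∀ W : Submodule K (Fin n → K),
          (W.map b⁻¹.1.mulVecLin).map b.1.mulVecLin = W := fun W => by
        rw [map_mulVecLin_map, Units.mul_inv, mulVecLin_one, Submodule.map_id]
      have hcoord : ∀ j, j ≠ a.1 + 1 → coordSpan K ((initialInterval n j).image (w l)) =
          ((coordSpan K (initialInterval n j)).map
            (evalMat t (G l * P)).mulVecLin).map b⁻¹.1.mulVecLin := fun j hj => by
        rw [map_mul, ← map_mulVecLin_map, hPj t j hj, hbk l le_rfl, hbinv]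
      have hf : w l (letterFst a) ∉ (initialInterval n a.1).image (w l) := by
        simp [mem_initialInterval, letterFst]
      have hs : w l (letterSnd a) ∉ (initialInterval n a.1).image (w l) := by
        simp [mem_initialInterval, letterSnd]
      have hmono : ∀ {i j : ℕ}, i ≤ j → initialInterval n i ⊆ initialInterval n j :=
        fun hij x hx => mem_initialInterval.2 ((mem_initialInterval.1 hx).trans_le hij)
      obtain ⟨c, hc⟩ := exists_eq_map_transvection (V := V) hf hs hlt.ne
        (by
          rw [hcoord a.1 (by omega)]
          exact Submodule.map_mono (Submodule.map_mono (coordSpan_mono (hmono (by omega)))))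
        (by
          rw [← image_initialInterval_letter_add_two, hcoord (a.1 + 2) (by omega)]
          exact Submodule.map_mono (Submodule.map_mono (coordSpan_mono (hmono (by omega)))))
        (by
          rw [hVdef, finrank_map_mulVecLin b⁻¹.isUnit, map_mul,
            finrank_map_mulVecLin ((hGu l le_rfl t).mul (hPu t)), finrank_coordSpan,
            card_image_initialInterval _ (by omega), card_initialInterval (by omega)])
        -- If V were E_{w_l[a+1]}, then cancelling b and G_l(t) would give P(t) K^(a+1) = K^(a+1),
        -- excluded for t ≠ 0.
        (by
          rw [← image_initialInterval_letter]
          intro h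
          refine hPt t ht (Submodule.map_injective_of_injective
            (f := (evalMat t (G l)).mulVecLin) (mulVec_injective_of_isUnit (hGu l le_rfl t)) ?_)
          have h' := congrArg (Submodule.map b.1.mulVecLin) h
          rw [hVdef, hbinv', ← hbk l le_rfl, map_mul, ← map_mulVecLin_map] at h'
          exact h')
      refine ⟨b * (isUnit_transvection hlt.ne c).unit,
        mul_mem hb (transvection_mem_borel hlt c), fun k hk j => ?_⟩
      -- The correcting transvection leaves the flags already matched by b untouched; this is where
      -- reducedness enters.
      have hfix : ∀ k ≤ l, (coordSpan K ((initialInterval n j).image (w k))).map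
          (mulVecLin (b * (isUnit_transvection hlt.ne c).unit).1) =
            (coordSpan K ((initialInterval n j).image (w k))).map (mulVecLin b.1) := fun k hk => by
        rw [Units.val_mul, ← map_mulVecLin_map, IsUnit.unit_spec,
          map_transvection_coordSpan hlt.ne]
        rw [mem_image_initialInterval, mem_image_initialInterval]
        exact fun h => (Fin.lt_def.1 (hasc k hk)).trans h
      dsimp only
      split_ifs with hkl
      · rw [hbk k hkl, hfix k hkl]
      · obtain rfl : k = l + 1 := by omega
        by_cases hj : j = a.1 + 1
        · rw [Units.val_mul, ← map_mulVecLin_map, IsUnit.unit_spec, hj, hwa,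
            image_mul_initialInterval_letter, ← hc, hVdef, hbinv']
        · rw [himg j hj, hfix l le_rfl, map_mul, ← map_mulVecLin_map, hPj t j hj, hbk l le_rfl]

end Deformation


/-! ### Zariski topology, morphisms and closed conditions via frames. -/

section Topology

open Matrix

variable {K : Type*} [Field K] {n : ℕ} {D D' : Finset (Finset (Fin n))}

/-- The Zariski topology of the variety of frames. -/
instance : TopologicalSpace (Frame K D) :=
  TopologicalSpace.induced Frame.entries (zariskiTopology K (FrameIndex D))

theorem continuous_toGrProd : Continuous (Frame.toGrProd : Frame K D → GrProd K D) :=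
  continuous_coinduced_rng

theorem isOpen_grProd_iff {U : Set (GrProd K D)} :
    IsOpen U ↔ IsOpen (Frame.toGrProd ⁻¹' U : Set (Frame K D)) :=
  isOpen_coinduced

theorem isOpen_eval_ne_zero (p : MvPolynomial (FrameIndex D) K) :
    IsOpen {A : Frame K D | MvPolynomial.eval A.entries p ≠ 0} :=
  letI := zariskiTopology K (FrameIndex D)
  isOpen_induced_iff.2 ⟨_, TopologicalSpace.isOpen_generateFrom_of_mem ⟨p, rfl⟩, rfl⟩

theorem continuous_of_forall_eval {X : Type*} [TopologicalSpace X] {f : X → Frame K D}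
    (hf : ∀ p : MvPolynomial (FrameIndex D) K,
      IsOpen {x | MvPolynomial.eval (f x).entries p ≠ 0}) : Continuous f := by
  refine continuous_induced_rng.2 (continuous_generateFrom_iff.2 ?_)
  rintro _ ⟨p, rfl⟩
  exact hf p

theorem Frame.exists_toGrProd_eq (x : GrProd K D) : ∃ A : Frame K D, A.toGrProd = x := by
  have b : ∀ C : {C // C ∈ D}, Module.Basis (Fin C.1.card) K (x C).1 := fun C =>
    Module.finBasisOfFinrankEq K (x C).1 (x C).2
  refine ⟨⟨fun C r s => (b C s).1 r, fun C => ?_⟩, ?_⟩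
  · exact (b C).linearIndependent.map' (x C).1.subtype (Submodule.ker_subtype _)
  · funext C
    refine Subtype.ext ?_
    change Submodule.span K (Set.range ((x C).1.subtype ∘ b C)) = (x C).1
    rw [Set.range_comp, ← Submodule.map_span, (b C).span_eq, Submodule.map_top,
      Submodule.range_subtype]

/-- A map of products of Grassmannians that lifts to a polynomial map of frames. -/
def LiftsToFrames (φ : GrProd K D → GrProd K D') : Prop :=
  ∃ (Φ : Frame K D → Frame K D') (P : FrameIndex D' → MvPolynomial (FrameIndex D) K),
    (∀ A, (Φ A).toGrProd = φ A.toGrProd) ∧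
      ∀ A e, (Φ A).entries e = MvPolynomial.eval A.entries (P e)

theorem eval_entries_bind₁ {Φ : Frame K D → Frame K D'}
    {P : FrameIndex D' → MvPolynomial (FrameIndex D) K}
    (hP : ∀ A e, (Φ A).entries e = MvPolynomial.eval A.entries (P e))
    (p : MvPolynomial (FrameIndex D') K) (A : Frame K D) :
    MvPolynomial.eval (Φ A).entries p = MvPolynomial.eval A.entries (MvPolynomial.bind₁ P p) := by
  rw [MvPolynomial.eval, MvPolynomial.eval, MvPolynomial.eval₂Hom_bind₁]
  congr 2
  exact funext (hP A)

theorem LiftsToFrames.continuous {φ : GrProd K D → GrProd K D'} (h : LiftsToFrames φ) :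
    Continuous φ := by
  obtain ⟨Φ, P, hΦ, hP⟩ := h
  refine continuous_coinduced_dom.2 ?_
  have : φ ∘ Frame.toGrProd = Frame.toGrProd ∘ Φ := funext fun A => (hΦ A).symm
  rw [this]
  refine continuous_toGrProd.comp (continuous_of_forall_eval fun p => ?_)
  simp only [eval_entries_bind₁ hP]
  exact isOpen_eval_ne_zero _

/-- Substituting the polynomial lift turns a local quotient p / q into another such quotient. -/
theorem LiftsToFrames.isMorphismOn {φ : GrProd K D → GrProd K D'} (h : LiftsToFrames φ)
    {Y : Set (GrProd K D)} {Y' : Set (GrProd K D')} (hY : Set.MapsTo φ Y Y') :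
    IsMorphismOn φ Y Y' := by
  refine ⟨hY, h.continuous.continuousOn, fun U _ f hf A hA => ?_⟩
  obtain ⟨Φ, P, hΦ, hP⟩ := h
  have hmem : ∀ A : Frame K D, A.toGrProd ∈ Y ∩ φ ⁻¹' U → (Φ A).toGrProd ∈ Y' ∩ U :=
    fun A hA => by
      rw [hΦ]
      exact ⟨hY hA.1, hA.2⟩
  obtain ⟨p, q, hq, hpq⟩ := hf (Φ A) (hmem A hA)
  refine ⟨MvPolynomial.bind₁ P p, MvPolynomial.bind₁ P q, ?_, fun A' hA' hq' => ?_⟩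
  · rwa [← eval_entries_bind₁ hP]
  · rw [← eval_entries_bind₁ hP] at hq' ⊢
    rw [← eval_entries_bind₁ hP, ← hpq (Φ A') (hmem A' hA') hq', Function.comp_apply, hΦ]

theorem liftsToFrames_proj (h : D ⊆ D') :
    LiftsToFrames (GrProd.proj h : GrProd K D' → GrProd K D) := by
  refine ⟨fun A => ⟨fun C => A.1 ⟨C.1, h C.2⟩, fun C => A.2 ⟨C.1, h C.2⟩⟩,
    fun e => MvPolynomial.X ⟨⟨e.1.1, h e.1.2⟩, e.2⟩, fun _ => rfl, fun A e => ?_⟩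
  rw [MvPolynomial.eval_X]
  rfl

/-- The map `Gr(D) → Gr(D')` that fills in the missing coordinates with those of `z_{D'}`. -/
noncomputable def GrProd.fill (D' : Finset (Finset (Fin n))) (x : GrProd K D) : GrProd K D' :=
  open Classical in fun C => if h : C.1 ∈ D then x ⟨C.1, h⟩ else coordinateSubspace K C.1

theorem GrProd.fill_of_mem (x : GrProd K D) {C : {C // C ∈ D'}} (h : C.1 ∈ D) :
    GrProd.fill D' x C = x ⟨C.1, h⟩ := dif_pos h

theorem GrProd.fill_of_notMem (x : GrProd K D) {C : {C // C ∈ D'}} (h : C.1 ∉ D) :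
    GrProd.fill D' x C = coordinateSubspace K C.1 := dif_neg h

/-- Missing blocks receive a fixed frame of z_{D'}, whose entries are constant polynomials. -/
theorem liftsToFrames_fill : LiftsToFrames (GrProd.fill D' : GrProd K D → GrProd K D') := by
  classical
  obtain ⟨Z, hZ⟩ := Frame.exists_toGrProd_eq (coordinatePoint K D')
  refine ⟨fun A => ⟨fun C => if h : C.1 ∈ D then A.1 ⟨C.1, h⟩ else Z.1 C, fun C => ?_⟩,
    fun e => if h : e.1.1 ∈ D then MvPolynomial.X ⟨⟨e.1.1, h⟩, e.2⟩
      else MvPolynomial.C (Z.entries e), fun A => ?_, fun A e => ?_⟩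
  · dsimp only
    split_ifs with h
    · exact A.2 ⟨C.1, h⟩
    · exact Z.2 C
  · funext C
    refine Subtype.ext ?_
    by_cases h : C.1 ∈ D
    · rw [GrProd.fill_of_mem _ h]
      simp only [Frame.toGrProd, dif_pos h]
    · rw [GrProd.fill_of_notMem _ h]
      have := congrArg Subtype.val (congrFun hZ C)
      simp only [Frame.toGrProd, dif_neg h] at this ⊢
      exact this
  · by_cases h : e.1.1 ∈ D
    · simp only [Frame.entries, dif_pos h, MvPolynomial.eval_X]
    · simp only [Frame.entries, dif_neg h, MvPolynomial.eval_C]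

/-- A point is in the closure of `S` if a polynomial family of frames joins it to points of `S`. -/
theorem mem_closure_of_polynomial_family [Infinite K] {S : Set (GrProd K D)}
    (γ : K → Frame K D) (P : FrameIndex D → Polynomial K)
    (hγ : ∀ t e, (γ t).entries e = (P e).eval t) (hS : ∀ t ≠ 0, (γ t).toGrProd ∈ S) :
    (γ 0).toGrProd ∈ closure S := by
  rw [mem_closure_iff]
  intro U hU h0
  -- A polynomial on frames pulls back along γ to a polynomial in t, which is zero or has finitely
  -- many roots; so γ is continuous for the cofinite topology, where 0 is not isolated.
  let _ : TopologicalSpace K := TopologicalSpace.cofinite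
  have hcof : ∀ s : Set K, IsOpen s ↔ (s.Nonempty → sᶜ.Finite) := fun _ => Iff.rfl
  have hcont : Continuous γ := by
    refine continuous_of_forall_eval fun p => (hcof _).2 fun ⟨s, hs⟩ => ?_
    have heval : ∀ t : K, MvPolynomial.eval (γ t).entries p =
        (MvPolynomial.aeval P p : Polynomial K).eval t := fun t => by
      rw [← Polynomial.coe_evalRingHom, MvPolynomial.map_aeval, MvPolynomial.eval]
      congr 2
      · ext x
        simp
      · exact funext (hγ t)
    have hne : (MvPolynomial.aeval P p : Polynomial K) ≠ 0 := fun h => hs (by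
      rw [heval, h, Polynomial.eval_zero])
    refine (Polynomial.finite_setOfPred_isRoot hne).subset fun t ht => ?_
    have ht' : MvPolynomial.eval (γ t).entries p = 0 := not_not.1 ht
    rwa [heval] at ht'
  have hopen := (hcof _).1 ((continuous_toGrProd.comp hcont).isOpen_preimage U hU) ⟨0, h0⟩
  obtain ⟨t, ht⟩ := (hopen.union (Set.finite_singleton (0 : K))).infinite_compl.nonempty
  rw [Set.compl_union, compl_compl] at ht
  exact ⟨_, ht.1, hS t ht.2⟩

/-- Incidence `V_C ⊆ V_{C'}` is a closed condition. -/
theorem isClosed_incidence (C C' : {C // C ∈ D}) :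
    IsClosed {x : GrProd K D | (x C).1 ≤ (x C').1} := by
  rw [← isOpen_compl_iff, isOpen_grProd_iff, isOpen_iff_forall_mem_open]
  intro A hA
  have hA' : ¬ Submodule.span K (Set.range (A.1 C).col) ≤
    Submodule.span K (Set.range (A.1 C').col) := hA
  rw [Submodule.span_le, Set.range_subset_iff, not_forall] at hA'
  obtain ⟨s, hs⟩ := hA'
  let Q : Matrix (Fin n) (Option (Fin C'.1.card)) (MvPolynomial (FrameIndex D) K) := fun r o =>
    o.elim (MvPolynomial.X ⟨C, r, s⟩) fun u => MvPolynomial.X ⟨C', r, u⟩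
  let M : Frame K D → Matrix (Fin n) (Option (Fin C'.1.card)) K := fun A r o =>
    o.elim (A.1 C r s) fun u => A.1 C' r u
  have hQM : ∀ A : Frame K D, Q.map (MvPolynomial.eval A.entries) = M A := fun A => by
    ext r (_ | u) <;> exact MvPolynomial.eval_X _
  have hind : LinearIndependent K (M A).col :=
    linearIndependent_option.2 ⟨A.2 C', hs⟩
  -- With a left inverse N of M A fixed, det (N * M A') is polynomial in A', equals 1 at A, and
  -- forces independent columns of M A' wherever it is nonzero. Non-incidence is therefore open.
  obtain ⟨L, hL⟩ := (M A).mulVecLin.exists_leftInverse_of_injective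
    (LinearMap.ker_eq_bot.2 (mulVec_injective_iff.2 hind))
  let N : Matrix (Option (Fin C'.1.card)) (Fin n) K := LinearMap.toMatrix' L
  have hN : N * M A = 1 := by
    have := congrArg LinearMap.toMatrix' hL
    rwa [LinearMap.toMatrix'_comp, LinearMap.toMatrix'_id, ← toLin'_apply',
      LinearMap.toMatrix'_toLin'] at this
  let N' : Matrix (Option (Fin C'.1.card)) (Fin n) (MvPolynomial (FrameIndex D) K) :=
    N.map MvPolynomial.C
  let p : MvPolynomial (FrameIndex D) K := (N' * Q).det
  have hp : ∀ A : Frame K D, MvPolynomial.eval A.entries p = (N * M A).det := fun A => by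
    rw [show p = (N' * Q).det from rfl, RingHom.map_det, RingHom.mapMatrix_apply, Matrix.map_mul, hQM]
    congr 2
    ext r s
    simp [N']
  refine ⟨_, fun A' hA' hle => ?_, isOpen_eval_ne_zero p, ?_⟩
  · have hunit : IsUnit (N * M A') := by
      rw [isUnit_iff_isUnit_det, isUnit_iff_ne_zero, ← hp]
      exact hA'
    have hinj : Function.Injective (M A').mulVec := by
      have := mulVec_injective_of_isUnit hunit
      intro u v huv
      refine this ?_
      simp only [← mulVec_mulVec, huv]
    exact (linearIndependent_option.1 (mulVec_injective_iff.1 hinj)).2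
      (hle (Submodule.subset_span ⟨s, rfl⟩))
  · change MvPolynomial.eval A.entries p ≠ 0
    rw [hp, hN, det_one]
    exact one_ne_zero

/-- `V_C = E_C` is a closed condition. -/
theorem isClosed_eq_coordinateSubspace (C : {C // C ∈ D}) :
    IsClosed {x : GrProd K D | x C = coordinateSubspace K C.1} := by
  -- Dimensions agree, so equality amounts to the vanishing of the frame entries in rows outside C.
  have hiff : ∀ A : Frame K D, A.toGrProd C = coordinateSubspace K C.1 ↔
      ∀ r, r ∉ C.1 → ∀ s, MvPolynomial.eval A.entries (MvPolynomial.X ⟨C, r, s⟩) = 0 := by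
    intro A
    simp only [MvPolynomial.eval_X]
    constructor
    · intro h r hr s
      have hmem : (A.1 C).col s ∈ coordSpan K C.1 := by
        rw [coordSpan, ← h]
        exact Submodule.subset_span ⟨s, rfl⟩
      exact mem_coordSpan.1 hmem r hr
    · intro h
      refine Subtype.ext (Submodule.eq_of_le_of_finrank_eq (Submodule.span_le.2 ?_) ?_)
      · rintro _ ⟨s, rfl⟩
        exact mem_coordSpan.2 fun r hr => h r hr s
      · rw [(A.toGrProd C).2, (coordinateSubspace K C.1).2]
  rw [← isOpen_compl_iff, isOpen_grProd_iff, isOpen_iff_forall_mem_open]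
  intro A hA
  have hA' := (hiff A).not.1 hA
  push Not at hA'
  obtain ⟨r, hr, s, hs⟩ := hA'
  exact ⟨{A' | MvPolynomial.eval A'.entries (MvPolynomial.X ⟨C, r, s⟩) ≠ 0},
    fun A' hA' h => hA' ((hiff A').1 h r hr s), isOpen_eval_ne_zero _, hs⟩

theorem isClosed_flaggedInclusionVariety : IsClosed (flaggedInclusionVariety K D) := by
  have : flaggedInclusionVariety K D =
      (⋂ (C : {C // C ∈ D}) (C' : {C // C ∈ D}) (_ : C.1 ⊆ C'.1), {x | (x C).1 ≤ (x C').1}) ∩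
        ⋂ (m : ℕ) (h : initialInterval n m ∈ D),
          {x | x ⟨initialInterval n m, h⟩ = coordinateSubspace K (initialInterval n m)} := by
    ext x
    simp [flaggedInclusionVariety]
  rw [this]
  exact (isClosed_iInter fun C => isClosed_iInter fun C' => isClosed_iInter fun _ =>
    isClosed_incidence C C').inter (isClosed_iInter fun m => isClosed_iInter fun h =>
      isClosed_eq_coordinateSubspace ⟨initialInterval n m, h⟩)

end Topology

/-! ### Comparison of the inclusion and configuration varieties. -/

section Varieties

open Matrix

variable {K : Type*} [Field K] {n : ℕ} {D D' : Finset (Finset (Fin n))}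

theorem smul_coe (b : GeneralLinearGroup (Fin n) K) (x : GrProd K D) (C : {C // C ∈ D}) :
    ((b • x) C).1 = (x C).1.map (mulVecLin b.1) := rfl

theorem proj_smul (h : D ⊆ D') (b : GeneralLinearGroup (Fin n) K) (x : GrProd K D') :
    GrProd.proj h (b • x) = b • GrProd.proj h x := rfl

theorem coordinatePoint_mem_flaggedInclusionVariety :
    coordinatePoint K D ∈ flaggedInclusionVariety K D :=
  ⟨fun _ _ h => coordSpan_mono h, fun _ _ => rfl⟩

theorem smul_mem_flaggedInclusionVariety {b : GeneralLinearGroup (Fin n) K} (hb : b ∈ borel K n)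
    {x : GrProd K D} (hx : x ∈ flaggedInclusionVariety K D) :
    b • x ∈ flaggedInclusionVariety K D := by
  refine ⟨fun C C' h => Submodule.map_mono (hx.1 C C' h), fun m h => Subtype.ext ?_⟩
  rw [smul_coe, hx.2 m h]
  exact map_borel_coordSpan hb m

theorem flaggedConfigurationVariety_subset_flaggedInclusionVariety :
    flaggedConfigurationVariety K D ⊆ flaggedInclusionVariety K D := by
  refine closure_minimal ?_ isClosed_flaggedInclusionVariety
  rintro _ ⟨b, rfl⟩
  exact smul_mem_flaggedInclusionVariety b.2 coordinatePoint_mem_flaggedInclusionVariety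

theorem mapsTo_flaggedConfigurationVariety {φ : GrProd K D → GrProd K D'} (hφ : Continuous φ)
    (h : ∀ b ∈ borel K n, φ (b • coordinatePoint K D) = b • coordinatePoint K D') :
    Set.MapsTo φ (flaggedConfigurationVariety K D) (flaggedConfigurationVariety K D') := by
  refine Set.MapsTo.closure ?_ hφ
  rintro _ ⟨b, rfl⟩
  exact ⟨b, (h b.1 b.2).symm⟩

/-- The filled-in coordinates are the subspaces K^m, which B stabilizes. -/
theorem fill_smul_coordinatePoint (hD : ∀ C ∈ D', C ∉ D → ∃ m, C = initialInterval n m)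
    {b : GeneralLinearGroup (Fin n) K} (hb : b ∈ borel K n) :
    GrProd.fill D' (b • coordinatePoint K D) = b • coordinatePoint K D' := by
  funext ⟨C, hC⟩
  by_cases h : C ∈ D
  · rw [GrProd.fill_of_mem _ h]
    rfl
  · rw [GrProd.fill_of_notMem _ h]
    obtain ⟨m, rfl⟩ := hD C hC h
    exact Subtype.ext (map_borel_coordSpan hb m).symm

theorem proj_fill (h : D ⊆ D') (x : GrProd K D) : GrProd.proj h (GrProd.fill D' x) = x :=
  funext fun C => GrProd.fill_of_mem x C.2

theorem fill_proj (h : D ⊆ D') (hD : ∀ C ∈ D', C ∉ D → ∃ m, C = initialInterval n m)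
    {x : GrProd K D'} (hx : x ∈ flaggedInclusionVariety K D') :
    GrProd.fill D' (GrProd.proj h x) = x := by
  funext ⟨C, hC⟩
  by_cases hCD : C ∈ D
  · rw [GrProd.fill_of_mem _ hCD]
    rfl
  · rw [GrProd.fill_of_notMem _ hCD]
    obtain ⟨m, rfl⟩ := hD C hC hCD
    exact (hx.2 m hC).symm

theorem exists_eq_initialInterval_of_notMem_chamberFamily {i : List (Fin (n - 1))}
    {C : Finset (Fin n)} (hC : C ∈ fullChamberFamily i) (h : C ∉ chamberFamily i) :
    ∃ m, C = initialInterval n m := by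
  obtain ⟨m, -, rfl⟩ := Finset.mem_image.1 ((Finset.mem_union.1 hC).resolve_right h)
  exact ⟨m, rfl⟩

theorem span_range_col_submatrix (g : Matrix (Fin n) (Fin n) K) {m : ℕ} (hm : m ≤ n) :
    Submodule.span K (Set.range (g.submatrix id (Fin.castLE hm)).col) =
      (coordSpan K (initialInterval n m)).map g.mulVecLin := by
  rw [coordSpan, coordinateSubspace, Submodule.map_span, ← Set.range_comp]
  congr 1
  ext v
  constructor
  · rintro ⟨s, rfl⟩
    refine ⟨⟨Fin.castLE hm s, mem_initialInterval.2 s.2⟩, ?_⟩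
    simp [Function.comp_apply]
    rfl
  · rintro ⟨⟨s, hs⟩, rfl⟩
    refine ⟨⟨s.1, mem_initialInterval.1 hs⟩, ?_⟩
    simp [Function.comp_apply]
    rfl

theorem flaggedInclusionVariety_subset_flaggedConfigurationVariety [Infinite K]
    {i : List (Fin (n - 1))} (hi : IsReducedWord i) :
    flaggedInclusionVariety K (fullChamberFamily i) ⊆
      flaggedConfigurationVariety K (fullChamberFamily i) := by
  classical
  intro x hx
  -- The default has the right dimension for every C; among the sets w_k[j], only the empty one can
  -- lie outside the family.
  let F : Finset (Fin n) → Submodule K (Fin n → K) := fun C =>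
    if h : C ∈ fullChamberFamily i then (x ⟨C, h⟩).1 else coordSpan K C
  have hFmem : ∀ {C} (h : C ∈ fullChamberFamily i), F C = (x ⟨C, h⟩).1 := fun h => dif_pos h
  have hFr : ∀ C, Module.finrank K (F C) = C.card := fun C => by
    by_cases h : C ∈ fullChamberFamily i
    · rw [hFmem h, (x ⟨C, h⟩).2]
    · rw [show F C = coordSpan K C from dif_neg h, finrank_coordSpan]
  obtain ⟨G, hGu, hG0, hGt⟩ := exists_polynomial_gallery (K := K) (l := i.length)
    (w := fun k => wordProd (i.take k)) (F := F) (by simp [wordProd])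
    (fun k hk => ⟨i[k], wordProd_take_succ i hk, fun m hm => hi.lt hm hk⟩)
    (fun j => by
      by_cases h : initialInterval n j ∈ fullChamberFamily i
      · rw [hFmem h, hx.2 j h]
        rfl
      · exact dif_neg h)
    hFr
    (fun k hk j hj => by
      rcases Nat.eq_zero_or_pos j with rfl | hj0
      · have h0 := hFr ((initialInterval n 0).image (wordProd (i.take k)))
        rw [card_image_initialInterval _ (Nat.zero_le _)] at h0
        rw [Submodule.finrank_eq_zero.1 h0]
        exact bot_le
      · rw [hFmem (image_mem_fullChamberFamily i hk hj0 (by omega)),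
          hFmem (image_mem_fullChamberFamily i hk (by omega) hj)]
        refine hx.1 _ _ (Finset.image_subset_image fun y hy => ?_)
        exact mem_initialInterval.2 ((mem_initialInterval.1 hy).trans (Nat.lt_succ_self j)))
  -- A flag κ C containing V_C is chosen; the first |C| columns of its matrix G (κ C) then give a
  -- polynomial frame for V_C.
  choose κ hκ hCκ using fun C : {C // C ∈ fullChamberFamily i} =>
    exists_eq_image_of_mem_fullChamberFamily C.2
  have hcard : ∀ C : Finset (Fin n), C.card ≤ n := fun C => by
    simpa using Finset.card_le_univ C
  let γ : K → Frame K (fullChamberFamily i) := fun t =>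
    ⟨fun C => (evalMat t (G (κ C))).submatrix id (Fin.castLE (hcard C.1)), fun C =>
      (linearIndependent_cols_of_isUnit (hGu (κ C) (hκ C) t)).comp _ (Fin.castLE_injective _)⟩
  have hγ : ∀ t C, ((γ t).toGrProd C).1 =
      (coordSpan K (initialInterval n C.1.card)).map (evalMat t (G (κ C))).mulVecLin := fun t C =>
    span_range_col_submatrix _ _
  have hx0 : (γ 0).toGrProd = x := by
    funext C
    refine Subtype.ext ?_
    rw [hγ, hG0 _ (hκ C), ← hCκ C, hFmem C.2]
  rw [← hx0]
  refine mem_closure_of_polynomial_family γ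
    (fun e => G (κ e.1) e.2.1 (Fin.castLE (hcard e.1.1) e.2.2)) (fun t e => rfl) fun t ht => ?_
  obtain ⟨b, hb, hbk⟩ := hGt t ht
  refine ⟨⟨b, hb⟩, funext fun C => Subtype.ext ?_⟩
  rw [hγ, hbk _ (hκ C), ← hCκ C]
  rfl

end Varieties

end BottSamelson
theorem theorem7 {K : Type*} [Field K] [IsAlgClosed K] (n : ℕ) (i : List (Fin (n - 1)))
    (hi : IsReducedWord i) :
    -- forgetting the standard flag is an isomorphism from the inclusion variety to `Z_i`
    IsIsomorphismOn (GrProd.proj (chamberFamily_subset i))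
      (flaggedInclusionVariety K (fullChamberFamily i)) (bottSamelsonVariety K i) ∧
    -- and it is an isomorphism of `B`-varieties
    (∀ b ∈ borel K n, ∀ x ∈ flaggedInclusionVariety K (fullChamberFamily i),
      b • x ∈ flaggedInclusionVariety K (fullChamberFamily i) ∧
      GrProd.proj (chamberFamily_subset i) (b • x) =
        b • GrProd.proj (chamberFamily_subset i) x) ∧
    -- inside `Gr(D_i^+)`, the inclusion variety is the closure of the `B`-orbit
    flaggedInclusionVariety K (fullChamberFamily i) =
      flaggedConfigurationVariety K (fullChamberFamily i) := by
  have hI : flaggedInclusionVariety K (fullChamberFamily i) =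
      flaggedConfigurationVariety K (fullChamberFamily i) :=
    (flaggedInclusionVariety_subset_flaggedConfigurationVariety hi).antisymm
      flaggedConfigurationVariety_subset_flaggedInclusionVariety
  have hD : ∀ C ∈ fullChamberFamily i, C ∉ chamberFamily i → ∃ m, C = initialInterval n m :=
    fun _ => exists_eq_initialInterval_of_notMem_chamberFamily
  refine ⟨⟨(liftsToFrames_proj _).isMorphismOn ?_, GrProd.fill _,
    liftsToFrames_fill.isMorphismOn ?_, fun x hx => fill_proj _ hD hx, fun x _ => proj_fill _ x⟩,
    fun b hb x hx => ⟨smul_mem_flaggedInclusionVariety hb hx, proj_smul _ b x⟩, hI⟩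
  -- That the projection lands in the orbit closure Z_i uses the equality of varieties, not just
  -- incidence.
  · rw [hI]
    exact mapsTo_flaggedConfigurationVariety (liftsToFrames_proj _).continuous fun _ _ => rfl
  · rw [hI]
    exact mapsTo_flaggedConfigurationVariety liftsToFrames_fill.continuous fun b hb =>
      fill_smul_coordinatePoint hD hb
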